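/- Let $(\mu_i)_{i\ge1}$ and $(\sigma_i^2)_{i\ge1}$ be real sequences with $\mu_i\le\mu_1$ and $0\le\sigma_i^2\le\bar\sigma^2$ for all $i$, where $0<\bar\sigma<\infty$. Let $X_{ij}$ ($i,j\ge1$) be independent random variables, $X_{ij}$ being normal with mean $\mu_i$ and variance $\sigma_i^2$, and let $\bar X_i(n)=\frac1n\sum_{j=1}^nX_{ij}$. For $k\ge1$ and $\delta>0$ let $\mathcal G=\mathcal G_k=\{i\in\{1,\dots,k\}:\mu_i>\mu_1-\delta\}$ be the set of good alternatives among the first $k$, and suppose that $\limsup_{k\to\infty}|\mathcal G_k|<\infty$. The explore-first greedy (EFG) procedure with $k$ alternatives, exploration size $n_0\ge1$ and total budget $B$ first takes $n_0$ observations from each of the alternatives $1,\dots,k$; then, while the total number of observations is less than $B$, it takes one further observation from an alternative with the largest current sample mean; finally it selects an alternative with the largest sample mean. Ties are broken by an arbitrary rule. The probability of good selection, ${\rm PGS}$, is the probability that the selected alternative belongs to $\mathcal G_k$. For $x>0$ let $C(x;n_0)={\rm E}\left[\inf\{n\ge n_0:\bar Z(n)<x\}\right]$, where $\bar Z(n)$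 is the average of the first $n$ terms of a sequence of independent standard normal random variables. Let $n_g$ be a real number with $n_g>C\left(\frac{\delta}{\bar\sigma};n_0\right)-n_0$, and for each $k$ let the budget be $B=(n_0+n_g)k$ (rounded up or down if this is not an integer). Then there is $\delta_0\in(0,\delta)$ with $C\left(\frac{\delta-\delta_0}{\bar\sigma};n_0\right)=n_0+n_g$, and for every such $\delta_0$ \[ \liminf_{k\to\infty}{\rm PGS}\ \ge\ \limsup_{k\to\infty}\Pr\left\{\exists\,i\in\mathcal G_k:\min_{n\ge n_0}\bar X_i(n)>\mu_1-\delta_0\right\}\ \ge\ \Pr\left\{\min_{n\ge n_0}\bar X_1(n)>\mu_1-\delta_0\right\}. \] -/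

import Mathlib

open MeasureTheory ProbabilityTheory Filter
open scoped ENNReal

noncomputable section

namespace EFG

/-- The running average of the first `n` observations of the sequence `x`
(the observations are `x 0, x 1, …`). -/
def runningAvg (x : ℕ → ℝ) (n : ℕ) : ℝ :=
  (∑ j ∈ Finset.range n, x j) / n

/-- The minimum of the running average over the sample sizes `n ≥ n₀`, as an infimum in the
extended reals. For Gaussian observations it is almost surely finite and attained. -/
def minRunningAvg (x : ℕ → ℝ) (n₀ : ℕ) : EReal :=
  ⨅ (n : ℕ) (_ : n₀ ≤ n), (runningAvg x n : EReal)

/-- The boundary-crossing time `inf {n ≥ n₀ : runningAvg z n < x}`, equal to `∞` if the running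
average never falls below `x`. -/
def crossingTime (x : ℝ) (n₀ : ℕ) (z : ℕ → ℝ) : ℝ≥0∞ :=
  ⨅ (n : ℕ) (_ : n₀ ≤ n ∧ runningAvg z n < x), (n : ℝ≥0∞)

/-- `C(x; n₀)`: the expected boundary-crossing time of the running average of independent
standard normal observations. -/
def C (x : ℝ) (n₀ : ℕ) : ℝ≥0∞ :=
  ∫⁻ z, crossingTime x n₀ z ∂(Measure.infinitePi fun _ : ℕ => gaussianReal 0 1)

/-- `a` picks, from every vector of values of the alternatives `0, …, k - 1`, an alternative
with the largest value; ties are broken in any way. -/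
def IsArgmaxRule (k : ℕ) (a : (ℕ → ℝ) → ℕ) : Prop :=
  ∀ v : ℕ → ℝ, a v < k ∧ ∀ i < k, v i ≤ v (a v)

/-- The sample sizes of the alternatives after the exploration phase, in which every alternative
gets `n₀` observations, and `t` observations of the greedy phase, each of which goes to an
alternative with the largest current sample mean. Here `x i j` is the `j`-th observation of
alternative `i`. -/
def sampleSizes (a : (ℕ → ℝ) → ℕ) (n₀ : ℕ) (x : ℕ → ℕ → ℝ) : ℕ → ℕ → ℕ
  | 0 => fun _ => n₀
  | t + 1 =>
    let n := sampleSizes a n₀ x t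
    let s := a fun i => runningAvg (x i) (n i)
    Function.update n s (n s + 1)

/-- The alternative selected by the explore-first greedy procedure with `k` alternatives, total
sampling budget `B` and exploration size `n₀`. The exploration phase uses `n₀ * k` observations,
and each greedy step uses one, so that the greedy phase has `B - n₀ * k` steps (none if
`B ≤ n₀ * k`); then an alternative with the largest sample mean is selected. -/
def selected (a : (ℕ → ℝ) → ℕ) (k n₀ B : ℕ) (x : ℕ → ℕ → ℝ) : ℕ :=
  a fun i => runningAvg (x i) (sampleSizes a n₀ x (B - n₀ * k) i)

/-- The good alternatives among `0, …, k - 1`: those with mean within `δ` of the mean of the best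
alternative, which is alternative `0`. -/
def goodSet (μ : ℕ → ℝ) (δ : ℝ) (k : ℕ) : Finset ℕ :=
  {i ∈ Finset.range k | μ 0 - δ < μ i}

/-- The probability of good selection of the explore-first greedy procedure. -/
def PGS {Ω : Type*} [MeasurableSpace Ω] (P : Measure Ω) (X : ℕ → ℕ → Ω → ℝ) (μ : ℕ → ℝ) (δ : ℝ)
    (a : (ℕ → ℝ) → ℕ) (k n₀ B : ℕ) : ℝ≥0∞ :=
  P {ω | selected a k n₀ B (fun i j => X i j ω) ∈ goodSet μ δ k}

end EFG

end

/-! Fix `d < δ₀` and suppose that some good alternative never falls below `c = μ 0 - d`. The leader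
is then always at or above `c`, so no alternative is sampled again once it is below `c`: each bad
one uses at most its crossing time of `c` (`sampleSizes_le_crossingTime`). Its mean is at most `μ 0
- δ` and its standard deviation at most `σbar`, so this time is dominated by a standard normal
crossing time of mean `C ((δ - d) / σbar) n₀`, strictly less than the budget per alternative `C ((δ
- δ₀) / σbar) n₀ = n₀ + ng`. By Chebyshev (`tendsto_measure_le_sum`), with probability tending to
one the bad alternatives leave more than any fixed number of observations to the good ones.

Enough such observations force a good selection. The running average of a nondegenerate good
alternative almost surely has a last strict minimum, at some `p`, because it converges to the mean
but dips below it at arbitrarily late times. To be sampled past `p` the alternative must lead at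
`p`; all bad averages are then at most that minimum, its own later averages exceed it, and no bad
alternative leads again (`leader_mem_of_lt_sampleSizes`). So a bad selection keeps every good sample
size at most its `p`, and the budget is at most a constant plus the bad crossing times
(`budget_le_of_selected_notMem`), which is rare. A union bound suffices, without conditioning on the
good alternatives. Finally `M → ∞`, where `M` bounds the times `p`, and `d ↑ δ₀`.

The number `δ₀` exists by the intermediate value theorem: `C` is continuous on the positive axis,
and unbounded near zero because Wald's identity gives `C 0 n₀ = ⊤`. -/

namespace EFG

open scoped NNReal Topology

/-! ### Partial sums of standard normal sequences: laws, tails, strong law. -/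

/-- The law of a sequence of independent standard normal random variables. -/
noncomputable abbrev stdSeq : Measure (ℕ → ℝ) :=
  Measure.infinitePi fun _ : ℕ => gaussianReal 0 1

theorem iIndepFun_coord : iIndepFun (fun j (z : ℕ → ℝ) => z j) stdSeq :=
  iIndepFun_infinitePi (X := fun _ x => x) (fun _ => measurable_id)

theorem map_coord (j : ℕ) : stdSeq.map (fun z => z j) = gaussianReal 0 1 :=
  Measure.infinitePi_map_eval _ j

theorem map_sum_coord (s : Finset ℕ) :
    stdSeq.map (fun z => ∑ j ∈ s, z j) = gaussianReal 0 (s.card : ℝ≥0) := by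
  classical
  induction s using Finset.induction with
  | empty => simp [gaussianReal_zero_var]
  | insert i s hi ih =>
    have hind : IndepFun (fun z : ℕ → ℝ => ∑ j ∈ s, z j) (fun z => z i) stdSeq := by
      have := iIndepFun_coord.indepFun_finsetSum_of_notMem (fun j => measurable_pi_apply j) hi
      convert this using 1
      ext z; simp
    have := gaussianReal_add_gaussianReal_of_indepFun hind ih (map_coord i)
    rw [Finset.card_insert_of_notMem hi]
    convert this using 2
    · ext z; simp [Finset.sum_insert hi, add_comm]
    · simp
    · simp

@[fun_prop]
theorem measurable_runningAvg (n : ℕ) : Measurable fun z : ℕ → ℝ => runningAvg z n := by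
  unfold runningAvg; fun_prop

theorem ae_runningAvg_ne (y : ℝ) : ∀ᵐ z ∂stdSeq, ∀ n ≥ 1, runningAvg z n ≠ y := by
  rw [ae_all_iff]; intro n
  rw [ae_all_iff]; intro hn
  have h : ∀ᵐ s ∂(stdSeq.map fun z => ∑ j ∈ Finset.range n, z j), s ≠ y * n := by
    rw [map_sum_coord]
    have := nullSingletonClass_gaussianReal (μ := 0) (v := ((Finset.range n).card : ℝ≥0))
      (by simp; omega)
    exact ae_iff.2 (by
      simp [-Finset.card_range])
  filter_upwards [ae_of_ae_map (by fun_prop) h] with z hz hzy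
  have : (n : ℝ) ≠ 0 := by positivity
  exact hz (by rw [← hzy, runningAvg]; field_simp)

theorem gaussianReal_Ici_le (v : ℝ≥0) {a : ℝ} (ha : 0 ≤ a) :
    gaussianReal 0 v (Set.Ici a) ≤ ENNReal.ofReal (Real.exp (-a ^ 2 / (2 * v))) := by
  have hsub : HasSubgaussianMGF id v (gaussianReal 0 v) :=
    ⟨fun t => integrable_exp_mul_gaussianReal t, fun t => by
      rw [mgf_id_gaussianReal]; simp⟩
  have := hsub.measure_ge_le ha
  rw [ENNReal.le_ofReal_iff_toReal_le (measure_ne_top _ _) (Real.exp_pos _).le]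
  exact this

theorem measure_sum_ge_le (n : ℕ) {a : ℝ} (ha : 0 ≤ a) :
    stdSeq {z | a ≤ ∑ j ∈ Finset.range n, z j} ≤
      ENNReal.ofReal (Real.exp (-a ^ 2 / (2 * n))) := by
  have h := gaussianReal_Ici_le (n : ℝ≥0) ha
  have h2 := map_sum_coord (Finset.range n)
  rw [Finset.card_range] at h2
  rw [← h2, Measure.map_apply (by fun_prop) measurableSet_Ici] at h
  simpa [Set.preimage] using h

theorem measure_runningAvg_ge_le {x : ℝ} (hx : 0 < x) (n : ℕ) :
    stdSeq {z | x ≤ runningAvg z n} ≤ ENNReal.ofReal (Real.exp (-(x ^ 2 / 2) * n)) := by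
  rcases Nat.eq_zero_or_pos n with rfl | hn
  · simp [runningAvg, not_le.2 hx]
  have hn' : (0 : ℝ) < n := by positivity
  have h := measure_sum_ge_le n (a := x * n) (by positivity)
  convert h using 3
  · ext z; simp [runningAvg, le_div_iff₀ hn']
  · field_simp

theorem tendsto_runningAvg :
    ∀ᵐ z ∂stdSeq, Tendsto (fun n => runningAvg z n) atTop (nhds 0) := by
  have hid (i : ℕ) : IdentDistrib (fun z : ℕ → ℝ => z i) (fun z => z 0) stdSeq stdSeq :=
    ⟨(measurable_pi_apply i).aemeasurable, (measurable_pi_apply 0).aemeasurable, by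
      rw [map_coord, map_coord]⟩
  have hint : Integrable (fun z : ℕ → ℝ => z 0) stdSeq := by
    have : Integrable id (stdSeq.map fun z => z 0) := by
      rw [map_coord]; exact (memLp_id_gaussianReal' 1 (by simp)).integrable le_rfl
    exact this.comp_measurable (by fun_prop)
  have h0 : ∫ z : ℕ → ℝ, z 0 ∂stdSeq = 0 := by
    have := integral_map (μ := stdSeq) (φ := fun z => z 0) (f := fun x => x)
      (measurable_pi_apply 0).aemeasurable (by fun_prop)
    rw [← this, map_coord, integral_id_gaussianReal]
  have := strong_law_ae_real (μ := stdSeq) (fun j z => z j) hint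
    (fun i j hij => iIndepFun_coord.indepFun hij) hid
  rw [h0] at this
  exact this

/-! ### Elementary properties of the crossing time. -/

theorem le_crossingTime_iff {x : ℝ} {n₀ : ℕ} {z : ℕ → ℝ} {m : ℕ} :
    (m : ℝ≥0∞) ≤ crossingTime x n₀ z ↔ ∀ n, n₀ ≤ n → runningAvg z n < x → m ≤ n := by
  simp [crossingTime]

theorem crossingTime_le {x : ℝ} {n₀ : ℕ} {z : ℕ → ℝ} {n : ℕ} (hn : n₀ ≤ n)
    (h : runningAvg z n < x) : crossingTime x n₀ z ≤ n :=
  iInf₂_le n ⟨hn, h⟩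

theorem crossingTime_anti {x y : ℝ} (hxy : x ≤ y) (n₀ : ℕ) (z : ℕ → ℝ) :
    crossingTime y n₀ z ≤ crossingTime x n₀ z :=
  le_iInf₂ fun _ hn => crossingTime_le hn.1 (hn.2.trans_le hxy)

theorem exists_crossingTime_eq {x : ℝ} {n₀ : ℕ} {z : ℕ → ℝ} {m : ℕ} (hm : n₀ ≤ m)
    (h : runningAvg z m < x) :
    ∃ n, n₀ ≤ n ∧ runningAvg z n < x ∧ crossingTime x n₀ z = n := by
  classical
  have hex : ∃ n, n₀ ≤ n ∧ runningAvg z n < x := ⟨m, hm, h⟩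
  obtain ⟨h1, h2⟩ := Nat.find_spec hex
  exact ⟨Nat.find hex, h1, h2, le_antisymm (crossingTime_le h1 h2)
    (le_crossingTime_iff.2 fun n hn hlt => Nat.find_min' hex ⟨hn, hlt⟩)⟩

theorem crossingTime_eq_top {x : ℝ} {n₀ : ℕ} {z : ℕ → ℝ}
    (h : ∀ n, n₀ ≤ n → x ≤ runningAvg z n) : crossingTime x n₀ z = ⊤ := by
  refine iInf₂_eq_top.2 fun n hn => absurd hn.2 (not_lt.2 (h n hn.1))

theorem exists_crossingTime_eq_of_ne_top {x : ℝ} {n₀ : ℕ} {z : ℕ → ℝ}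
    (h : crossingTime x n₀ z ≠ ⊤) :
    ∃ n, n₀ ≤ n ∧ runningAvg z n < x ∧ crossingTime x n₀ z = n := by
  by_contra hcon
  refine h (crossingTime_eq_top fun n hn => ?_)
  by_contra hlt
  exact hcon (exists_crossingTime_eq hn (not_le.1 hlt))

@[fun_prop]
theorem measurable_crossingTime (x : ℝ) (n₀ : ℕ) : Measurable (crossingTime x n₀) := by
  classical
  have : crossingTime x n₀ = fun z => ⨅ n : ℕ,
      if z ∈ {z : ℕ → ℝ | n₀ ≤ n ∧ runningAvg z n < x} then (n : ℝ≥0∞) else ⊤ := by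
    ext z
    simp only [crossingTime, Set.mem_ofPred_eq]
    congr! with n
    split_ifs with h <;> simp [h]
  rw [this]
  refine .iInf fun n => Measurable.ite ?_ measurable_const measurable_const
  exact (MeasurableSet.const _).inter (measurableSet_lt (measurable_runningAvg n) measurable_const)

theorem tsum_indicator_natCast_lt (t : ℝ≥0∞) (ht : t = ⊤ ∨ ∃ n : ℕ, t = n) :
    ∑' j : ℕ, (if ((j + 1 : ℕ) : ℝ≥0∞) ≤ t then 1 else 0) = t := by
  rcases ht with rfl | ⟨n, rfl⟩
  · simp
  · rw [tsum_eq_sum (s := Finset.range n)]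
    · rw [Finset.sum_congr rfl (g := fun _ => 1)]
      · simp
      · intro j hj
        rw [if_pos (by exact_mod_cast Finset.mem_range.1 hj)]
    · intro j hj
      rw [if_neg]
      rw [Nat.cast_le]
      simpa using hj

theorem crossingTime_eq_tsum (x : ℝ) (n₀ : ℕ) (z : ℕ → ℝ) :
    crossingTime x n₀ z =
      ∑' j : ℕ, (if ((j + 1 : ℕ) : ℝ≥0∞) ≤ crossingTime x n₀ z then 1 else 0) := by
  refine (tsum_indicator_natCast_lt _ ?_).symm
  by_cases h : crossingTime x n₀ z = ⊤
  · exact Or.inl h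
  · obtain ⟨n, -, -, hn⟩ := exists_crossingTime_eq_of_ne_top h
    exact Or.inr ⟨n, hn⟩

/-! ### Independence of disjoint blocks and Wald's identity. -/

/-- Restriction is expressed by zeroing the other coordinates, so that functionals of whole
sequences which ignore those coordinates can be composed with it directly. -/
theorem indepFun_indicator {S T : Finset ℕ} (h : Disjoint S T) :
    IndepFun (fun z : ℕ → ℝ => (S : Set ℕ).indicator z) (fun z => (T : Set ℕ).indicator z)
      stdSeq := by
  have key (U : Finset ℕ) : Measurable fun (y : U → ℝ) (i : ℕ) =>
      if hi : i ∈ U then y ⟨i, hi⟩ else 0 := by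
    refine measurable_pi_lambda _ fun i => ?_
    by_cases hi : i ∈ U
    · simpa [hi] using measurable_pi_apply _
    · simp [hi]
  have := (iIndepFun_coord.indepFun_finset S T h (fun i => measurable_pi_apply i)).comp
    (key S) (key T)
  convert this using 1 <;> ext z i <;> simp [Set.indicator]

theorem measure_inter_eq_mul {S T : Finset ℕ} (h : Disjoint S T) {A B : Set (ℕ → ℝ)}
    (hA : MeasurableSet A) (hB : MeasurableSet B)
    (hAS : ∀ z, (S : Set ℕ).indicator z ∈ A ↔ z ∈ A)
    (hBT : ∀ z, (T : Set ℕ).indicator z ∈ B ↔ z ∈ B) :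
    stdSeq (A ∩ B) = stdSeq A * stdSeq B := by
  have := (indepFun_indicator h).measure_inter_preimage_eq_mul A B hA hB
  have e1 : (fun z : ℕ → ℝ => (S : Set ℕ).indicator z) ⁻¹' A = A := by ext z; exact hAS z
  have e2 : (fun z : ℕ → ℝ => (T : Set ℕ).indicator z) ⁻¹' B = B := by ext z; exact hBT z
  rwa [e1, e2] at this

theorem runningAvg_indicator {S : Finset ℕ} {z : ℕ → ℝ} {n : ℕ} (h : Finset.range n ⊆ S) :
    runningAvg ((S : Set ℕ).indicator z) n = runningAvg z n := by
  unfold runningAvg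
  congr 1
  exact Finset.sum_congr rfl fun j hj => Set.indicator_of_mem (by exact_mod_cast h hj) _

/-- Optional stopping for a functional of one observation: whether sampling goes on beyond the
first `j` observations is independent of observation `j`. -/
theorem lintegral_coord_mul_crossingTime (x : ℝ) (n₀ j : ℕ) {f : ℝ → ℝ≥0∞} (hf : Measurable f) :
    ∫⁻ z, f (z j) * (if ((j + 1 : ℕ) : ℝ≥0∞) ≤ crossingTime x n₀ z then 1 else 0) ∂stdSeq =
      (∫⁻ y, f y ∂gaussianReal 0 1) *
        ∫⁻ z, (if ((j + 1 : ℕ) : ℝ≥0∞) ≤ crossingTime x n₀ z then 1 else 0) ∂stdSeq := by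
  have hm : Measurable fun z => if ((j + 1 : ℕ) : ℝ≥0∞) ≤ crossingTime x n₀ z
      then (1 : ℝ≥0∞) else 0 :=
    Measurable.ite (measurableSet_le measurable_const (by fun_prop)) measurable_const
      measurable_const
  have hind := (indepFun_indicator (S := {j}) (T := Finset.range j) (by simp)).comp
    (hf.comp (measurable_pi_apply j)) hm
  have e1 : (f ∘ fun z : ℕ → ℝ => z j) ∘
      (fun z : ℕ → ℝ => ((({j} : Finset ℕ)) : Set ℕ).indicator z) = fun z => f (z j) := by
    ext z; simp
  have e2 : (fun z => if ((j + 1 : ℕ) : ℝ≥0∞) ≤ crossingTime x n₀ z then (1 : ℝ≥0∞) else 0) ∘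
      (fun z : ℕ → ℝ => (Finset.range j : Set ℕ).indicator z) =
      fun z => if ((j + 1 : ℕ) : ℝ≥0∞) ≤ crossingTime x n₀ z then (1 : ℝ≥0∞) else 0 := by
    ext z
    simp only [Function.comp_apply]
    congr 1
    rw [le_crossingTime_iff, le_crossingTime_iff, eq_iff_iff]
    refine forall_congr' fun n => forall_congr' fun _ => ?_
    by_cases hn : j + 1 ≤ n
    · simp [hn]
    · rw [runningAvg_indicator (Finset.range_mono (by omega))]
  rw [e1, e2] at hind
  have := lintegral_mul_eq_lintegral_mul_lintegral_of_indepFun (by fun_prop) hm hind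
  simp only [Pi.mul_apply] at this
  rw [this]
  congr 1
  rw [← map_coord j, lintegral_map hf (measurable_pi_apply j)]

/-- Wald's identity for a functional of the observations. -/
theorem lintegral_sum_crossingTime (x : ℝ) (n₀ : ℕ) {f : ℝ → ℝ≥0∞} (hf : Measurable f) :
    ∫⁻ z, ∑' j : ℕ, f (z j) * (if ((j + 1 : ℕ) : ℝ≥0∞) ≤ crossingTime x n₀ z then 1 else 0)
      ∂stdSeq = (∫⁻ y, f y ∂gaussianReal 0 1) * C x n₀ := by
  have hm (j : ℕ) : Measurable fun z => if ((j + 1 : ℕ) : ℝ≥0∞) ≤ crossingTime x n₀ z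
      then (1 : ℝ≥0∞) else 0 :=
    Measurable.ite (measurableSet_le measurable_const (by fun_prop)) measurable_const
      measurable_const
  have hC : C x n₀ = ∑' j : ℕ, ∫⁻ z, (if ((j + 1 : ℕ) : ℝ≥0∞) ≤ crossingTime x n₀ z
      then 1 else 0) ∂stdSeq := by
    rw [← lintegral_tsum fun j => (hm j).aemeasurable]
    exact lintegral_congr fun z => crossingTime_eq_tsum x n₀ z
  have hfj (j : ℕ) : Measurable fun z : ℕ → ℝ => f (z j) := hf.comp (measurable_pi_apply j)
  rw [lintegral_tsum, hC, ← ENNReal.tsum_mul_left]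
  swap
  · exact fun j => ((hfj j).mul (hm j)).aemeasurable
  exact tsum_congr fun j => lintegral_coord_mul_crossingTime x n₀ j hf

theorem lintegral_ofReal_neg_gaussianReal :
    ∫⁻ y, ENNReal.ofReal (-y) ∂gaussianReal 0 1 = ∫⁻ y, ENNReal.ofReal y ∂gaussianReal 0 1 := by
  have h : (gaussianReal 0 1).map (fun y => -y) = gaussianReal 0 1 := by
    rw [gaussianReal_map_neg, neg_zero]
  conv_rhs => rw [← h]
  rw [lintegral_map (by fun_prop) (by fun_prop)]

theorem sum_ofReal_lt_sum_ofReal_neg {ι : Type*} (s : Finset ι) (z : ι → ℝ)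
    (h : ∑ j ∈ s, z j < 0) :
    ∑ j ∈ s, ENNReal.ofReal (z j) < ∑ j ∈ s, ENNReal.ofReal (-z j) := by
  have e (y : ℝ) : ENNReal.ofReal y = ENNReal.ofReal (max y 0) := by
    rcases le_total y 0 with hy | hy <;> simp [hy]
  have key : ∑ j ∈ s, max (z j) 0 - ∑ j ∈ s, max (-z j) 0 < 0 := by
    rw [← Finset.sum_sub_distrib]
    convert h using 2 with j
    rcases le_total (z j) 0 with hy | hy <;> simp [hy]
  have hp : 0 ≤ ∑ j ∈ s, max (z j) 0 := Finset.sum_nonneg fun _ _ => le_max_right _ _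
  simp_rw [fun j => e (z j), fun j => e (-z j)]
  rw [← ENNReal.ofReal_sum_of_nonneg fun _ _ => le_max_right _ _,
    ← ENNReal.ofReal_sum_of_nonneg fun _ _ => le_max_right _ _, ENNReal.ofReal_lt_ofReal_iff]
  · linarith
  · linarith

/-- If the mean were finite, Wald's identity for the positive and the negative parts, which have
equal means, would give their stopped sums equal finite expectations. But the stopped sum is almost
surely negative, so the negative parts strictly outweigh the positive ones. -/
theorem C_zero {n₀ : ℕ} (hn₀ : 1 ≤ n₀) : C 0 n₀ = ⊤ := by
  by_contra hC
  have hfin : ∀ᵐ z ∂stdSeq, crossingTime 0 n₀ z < ⊤ :=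
    ae_lt_top (measurable_crossingTime 0 n₀) hC
  have h1 := lintegral_sum_crossingTime 0 n₀ (f := ENNReal.ofReal) (by fun_prop)
  have h2 := lintegral_sum_crossingTime 0 n₀ (f := fun y => ENNReal.ofReal (-y)) (by fun_prop)
  rw [lintegral_ofReal_neg_gaussianReal, ← h1] at h2
  have hc : ∫⁻ y, ENNReal.ofReal y ∂gaussianReal 0 1 ≠ ⊤ := by
    have : Integrable id (gaussianReal 0 1) :=
      (memLp_id_gaussianReal' 1 (by simp)).integrable le_rfl
    exact this.lintegral_lt_top.ne
  refine (lintegral_strict_mono (IsProbabilityMeasure.ne_zero stdSeq) ?_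
    (h1.trans_ne (ENNReal.mul_ne_top hc hC)) ?_).ne' h2
  · refine Measurable.aemeasurable (Measurable.tsum fun j => Measurable.mul ?_ ?_)
    · exact (by fun_prop : Measurable fun y : ℝ => ENNReal.ofReal (-y)).comp
        (measurable_pi_apply j)
    · exact Measurable.ite (measurableSet_le measurable_const (by fun_prop)) measurable_const
        measurable_const
  · filter_upwards [hfin] with z hz
    obtain ⟨n, hn, hlt, hT⟩ := exists_crossingTime_eq_of_ne_top hz.ne
    have hsum (g : ℕ → ℝ≥0∞) : ∑' j : ℕ, g j *
        (if ((j + 1 : ℕ) : ℝ≥0∞) ≤ crossingTime 0 n₀ z then 1 else 0) =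
        ∑ j ∈ Finset.range n, g j := by
      rw [tsum_eq_sum (s := Finset.range n)]
      · refine Finset.sum_congr rfl fun j hj => ?_
        rw [hT, if_pos (Nat.cast_le.2 (Finset.mem_range.1 hj)), mul_one]
      · intro j hj
        rw [hT, if_neg (by rw [Nat.cast_le]; simpa using hj), mul_zero]
    rw [hsum, hsum]
    refine sum_ofReal_lt_sum_ofReal_neg _ _ ?_
    have hnpos : (0 : ℝ) < n := by exact_mod_cast (by omega : 0 < n)
    have := (div_lt_iff₀ hnpos).1 hlt
    simpa using this

/-! ### Finiteness, continuity, strict monotonicity and blow-up of `C`. -/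

/-- Only the finitely many averages before time `m` matter, and without equality each of their
inequalities is an open condition on the level. -/
theorem eventually_le_crossingTime {x : ℝ} {n₀ : ℕ} (hn₀ : 1 ≤ n₀) {z : ℕ → ℝ}
    (hz : ∀ n ≥ 1, runningAvg z n ≠ x) {m : ℕ} (hm : (m : ℝ≥0∞) ≤ crossingTime x n₀ z) :
    ∀ᶠ y in 𝓝 x, (m : ℝ≥0∞) ≤ crossingTime y n₀ z := by
  have h : ∀ n ∈ Finset.Ico n₀ m, ∀ᶠ y in 𝓝 x, y < runningAvg z n := by
    intro n hn
    rw [Finset.mem_Ico] at hn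
    refine eventually_lt_nhds (lt_of_le_of_ne ?_ (hz n (by omega)).symm)
    by_contra hlt
    exact absurd (le_crossingTime_iff.1 hm n hn.1 (not_le.1 hlt)) (by omega)
  filter_upwards [(Finset.eventually_all _).2 h] with y hy
  refine le_crossingTime_iff.2 fun n hn hlt => ?_
  by_contra hnm
  exact absurd (hy n (Finset.mem_Ico.2 ⟨hn, by omega⟩)) (not_lt.2 hlt.le)

theorem eventually_crossingTime_eq {x : ℝ} {n₀ : ℕ} (hn₀ : 1 ≤ n₀) {z : ℕ → ℝ}
    (hz : ∀ n ≥ 1, runningAvg z n ≠ x) (hT : crossingTime x n₀ z ≠ ⊤) :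
    ∀ᶠ y in 𝓝 x, crossingTime y n₀ z = crossingTime x n₀ z := by
  obtain ⟨n, hn, hlt, hTn⟩ := exists_crossingTime_eq_of_ne_top hT
  filter_upwards [eventually_le_crossingTime hn₀ hz hTn.ge, eventually_gt_nhds hlt] with y h1 h2
  rw [hTn]
  exact le_antisymm (crossingTime_le hn h2) h1

/-- Crossing at `n + 1 > n₀` means that the average at `n` was still at least `x`, so a single term
of the series is enough. Gaussian tails make the series integrable for `x > 0`. -/
theorem sq_crossingTime_le (x : ℝ) (n₀ : ℕ) (z : ℕ → ℝ) :
    crossingTime x n₀ z ^ 2 ≤ (n₀ : ℝ≥0∞) ^ 2 +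
      ∑' n : ℕ, ((n + 1 : ℕ) : ℝ≥0∞) ^ 2 * {z | x ≤ runningAvg z n}.indicator 1 z := by
  have key (m : ℕ) (hm : (m : ℝ≥0∞) ≤ crossingTime x n₀ z) : (m : ℝ≥0∞) ^ 2 ≤
      (n₀ : ℝ≥0∞) ^ 2 +
        ∑' n : ℕ, ((n + 1 : ℕ) : ℝ≥0∞) ^ 2 * {z | x ≤ runningAvg z n}.indicator 1 z := by
    rcases le_or_gt m n₀ with h | h
    · exact le_add_right (by gcongr)
    · obtain ⟨k, rfl⟩ : ∃ k, m = k + 1 := ⟨m - 1, by omega⟩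
      refine le_add_left (le_trans ?_ (ENNReal.le_tsum k))
      have hk : x ≤ runningAvg z k := by
        by_contra hlt
        exact absurd (le_crossingTime_iff.1 hm k (by omega) (not_le.1 hlt)) (by omega)
      rw [Set.indicator_of_mem (by exact hk)]
      simp
  by_cases hT : crossingTime x n₀ z = ⊤
  · refine le_of_le_of_eq le_top (Eq.symm ?_)
    refine ENNReal.eq_top_of_forall_nnreal_le fun r => ?_
    obtain ⟨m, hm⟩ := exists_nat_ge r
    calc (r : ℝ≥0∞) ≤ (m : ℝ≥0∞) := by exact_mod_cast hm
      _ ≤ (m : ℝ≥0∞) ^ 2 := by exact_mod_cast Nat.le_self_pow two_ne_zero m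
      _ ≤ _ := key m (by simp [hT])
  · obtain ⟨n, -, -, hTn⟩ := exists_crossingTime_eq_of_ne_top hT
    rw [hTn]
    exact key n hTn.ge

theorem lintegral_sq_crossingTime_lt_top {x : ℝ} (hx : 0 < x) (n₀ : ℕ) :
    ∫⁻ z, crossingTime x n₀ z ^ 2 ∂stdSeq < ⊤ := by
  have hms (n : ℕ) : MeasurableSet {z : ℕ → ℝ | x ≤ runningAvg z n} :=
    measurableSet_le measurable_const (by fun_prop)
  refine (lintegral_mono (sq_crossingTime_le x n₀)).trans_lt ?_
  rw [lintegral_add_left measurable_const, lintegral_tsum]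
  swap
  · exact fun n => (measurable_const.mul (measurable_one.indicator (hms n))).aemeasurable
  refine ENNReal.add_lt_top.2 ⟨by simp [ENNReal.pow_lt_top_iff], ?_⟩
  have hsum : Summable fun n : ℕ => ((n + 1 : ℕ) : ℝ) ^ 2 * Real.exp (-(x ^ 2 / 2) * n) := by
    have h := ((summable_nat_add_iff 1).2
      (Real.summable_pow_mul_exp_neg_nat_mul 2 (r := x ^ 2 / 2) (by positivity))).mul_left
      (Real.exp (x ^ 2 / 2))
    refine h.congr fun n => ?_
    rw [mul_left_comm, ← Real.exp_add]
    congr 2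
    push_cast; ring
  refine lt_of_le_of_lt (ENNReal.tsum_le_tsum (g := fun n : ℕ => ENNReal.ofReal
    (((n + 1 : ℕ) : ℝ) ^ 2 * Real.exp (-(x ^ 2 / 2) * n))) fun n => ?_) hsum.tsum_ofReal_lt_top
  rw [lintegral_const_mul _ (measurable_one.indicator (hms n)), lintegral_indicator_one (hms n),
    ENNReal.ofReal_mul (by positivity), ENNReal.ofReal_pow (by positivity), ENNReal.ofReal_natCast]
  gcongr
  exact measure_runningAvg_ge_le hx n

theorem C_lt_top {x : ℝ} (hx : 0 < x) (n₀ : ℕ) : C x n₀ < ⊤ := by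
  have h (t : ℝ≥0∞) : t ≤ 1 + t ^ 2 := by
    rcases le_total t 1 with ht | ht
    · exact le_add_right ht
    · exact le_add_left (le_self_pow₀ ht two_ne_zero)
  refine (lintegral_mono fun z => h (crossingTime x n₀ z)).trans_lt ?_
  rw [lintegral_add_left measurable_const]
  exact ENNReal.add_lt_top.2 ⟨by simp, lintegral_sq_crossingTime_lt_top hx n₀⟩

theorem ae_crossingTime_ne_top {x : ℝ} (hx : 0 < x) (n₀ : ℕ) :
    ∀ᵐ z ∂stdSeq, crossingTime x n₀ z ≠ ⊤ := by
  filter_upwards [ae_lt_top (measurable_crossingTime x n₀) (C_lt_top hx n₀).ne] with z hz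
  exact hz.ne

theorem continuousAt_C {x : ℝ} (hx : 0 < x) {n₀ : ℕ} (hn₀ : 1 ≤ n₀) :
    ContinuousAt (fun y => C y n₀) x := by
  refine tendsto_lintegral_filter_of_dominated_convergence (crossingTime (x / 2) n₀) ?_ ?_
    (C_lt_top (half_pos hx) n₀).ne ?_
  · exact Eventually.of_forall fun y => measurable_crossingTime y n₀
  · filter_upwards [eventually_ge_nhds (half_lt_self hx)] with y hy
    exact ae_of_all _ fun z => crossingTime_anti hy n₀ z
  · filter_upwards [ae_crossingTime_ne_top hx n₀, ae_runningAvg_ne x] with z h1 h2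
    exact tendsto_const_nhds.congr' ((eventually_crossingTime_eq hn₀ h2 h1).mono fun y hy => hy.symm)

/-- Monotone convergence along levels decreasing to zero transfers `C_zero` to small positive
levels. -/
theorem exists_lt_C {n₀ : ℕ} (hn₀ : 1 ≤ n₀) {t : ℝ≥0∞} (ht : t < ⊤) {x : ℝ} (hx : 0 < x) :
    ∃ y ∈ Set.Ioo 0 x, t < C y n₀ := by
  obtain ⟨u, hu, hu0, hul⟩ := exists_seq_strictAnti_tendsto' hx
  have hlim : ⨆ m, C (u m) n₀ = ⊤ := by
    unfold C
    rw [← lintegral_iSup (fun m => measurable_crossingTime _ _)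
      fun i j hij z => crossingTime_anti (hu.antitone hij) n₀ z]
    refine eq_top_mono (lintegral_mono_ae ?_) (C_zero hn₀)
    filter_upwards [ae_runningAvg_ne 0] with z hz
    have key (m : ℕ) (hm : (m : ℝ≥0∞) ≤ crossingTime 0 n₀ z) :
        (m : ℝ≥0∞) ≤ ⨆ k, crossingTime (u k) n₀ z := by
      obtain ⟨k, hk⟩ := (hul.eventually (eventually_le_crossingTime hn₀ hz hm)).exists
      exact hk.trans (le_iSup (fun k => crossingTime (u k) n₀ z) k)
    by_cases hT : crossingTime 0 n₀ z = ⊤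
    · refine le_of_le_of_eq le_top (ENNReal.eq_top_of_forall_nnreal_le fun r => ?_).symm
      obtain ⟨m, hm⟩ := exists_nat_ge r
      exact le_trans (by exact_mod_cast hm) (key m (by simp [hT]))
    · obtain ⟨n, -, -, hTn⟩ := exists_crossingTime_eq_of_ne_top hT
      rw [hTn]
      exact key n hTn.ge
  obtain ⟨m, hm⟩ := lt_iSup_iff.1 (hlim ▸ ht)
  exact ⟨u m, hu0 m, hm⟩

theorem exists_C_eq {n₀ : ℕ} (hn₀ : 1 ≤ n₀) {t : ℝ≥0∞} (ht : t < ⊤) {x : ℝ} (hx : 0 < x)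
    (hxt : C x n₀ < t) : ∃ y ∈ Set.Ioo 0 x, C y n₀ = t := by
  obtain ⟨y, hy, hty⟩ := exists_lt_C hn₀ ht hx
  obtain ⟨w, hw, hwt⟩ := intermediate_value_Icc' hy.2.le (f := fun y => C y n₀)
    (fun w hw => (continuousAt_C (hy.1.trans_le hw.1) hn₀).continuousWithinAt) ⟨hxt.le, hty.le⟩
  refine ⟨w, ⟨hy.1.trans_le hw.1, lt_of_le_of_ne hw.2 ?_⟩, hwt⟩
  rintro rfl
  exact hxt.ne hwt

theorem gaussianReal_ne_zero_of_isOpen {v : ℝ≥0} (hv : v ≠ 0) {U : Set ℝ} (hU : IsOpen U)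
    (hne : U.Nonempty) (m : ℝ) : gaussianReal m v U ≠ 0 := fun h =>
  (hU.measure_pos volume hne).ne' (gaussianReal_absolutelyContinuous' m hv h)

/-- With positive probability the average at `n₀` lies strictly between the levels; then `y` is
crossed at `n₀` and `x` only later. -/
theorem C_lt_C {x y : ℝ} (hx : 0 < x) (hxy : x < y) {n₀ : ℕ} (hn₀ : 1 ≤ n₀) :
    C y n₀ < C x n₀ := by
  have hn' : (0 : ℝ) < n₀ := by exact_mod_cast hn₀
  refine lintegral_strict_mono_of_ae_le_of_ae_lt_on (s := {z | runningAvg z n₀ ∈ Set.Ioo x y})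
    (measurable_crossingTime x n₀).aemeasurable (C_lt_top (hx.trans hxy) n₀).ne
    (ae_of_all _ fun z => crossingTime_anti hxy.le n₀ z) ?_ (ae_of_all _ fun z hz => ?_)
  · have h := gaussianReal_ne_zero_of_isOpen (v := ((Finset.range n₀).card : ℝ≥0))
      (by simp; omega) (isOpen_Ioo (a := x * n₀) (b := y * n₀))
      (Set.nonempty_Ioo.2 (by gcongr)) 0
    rw [← map_sum_coord, Measure.map_apply (by fun_prop) measurableSet_Ioo] at h
    convert h using 2
    ext z
    simp [runningAvg, lt_div_iff₀ hn', div_lt_iff₀ hn']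
  · refine (crossingTime_le le_rfl hz.2).trans_lt
      (lt_of_lt_of_le (b := ((n₀ + 1 : ℕ) : ℝ≥0∞)) (by exact_mod_cast n₀.lt_succ_self) ?_)
    refine le_crossingTime_iff.2 fun n hn hlt => ?_
    rcases hn.eq_or_lt with rfl | h
    · exact absurd hlt (not_lt.2 hz.1.le)
    · exact h

/-! ### Late dips below the mean and the last minimum. -/

theorem gaussianReal_Ioi_neg_le {v : ℝ≥0} (hv : v ≠ 0) {t : ℝ} (ht : t ^ 2 ≤ v) :
    gaussianReal 0 v (Set.Ioi (-t)) ≤ gaussianReal 0 1 (Set.Ioi (-1)) := by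
  have hs : (0 : ℝ) < √(v : ℝ) := Real.sqrt_pos.2 (by positivity)
  have h : (gaussianReal 0 1).map (fun y => √(v : ℝ) * y) = gaussianReal 0 v := by
    rw [gaussianReal_map_const_mul]
    congr 1
    · simp
    · ext; simp
  rw [← h, Measure.map_apply (by fun_prop) measurableSet_Ioi]
  refine measure_mono fun y hy => ?_
  have h1 : t ≤ √(v : ℝ) := Real.le_sqrt_of_sq_le ht
  have h2 : -t < √(v : ℝ) * y := hy
  have h3 : √(v : ℝ) * (-1) < √(v : ℝ) * y := by linarith
  exact lt_of_mul_lt_mul_left h3 hs.le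

theorem gaussianReal_Ioi_lt_one : gaussianReal 0 1 (Set.Ioi (-1)) < 1 := by
  refine lt_of_le_of_ne prob_le_one fun h => ?_
  have h2 := (prob_compl_eq_zero_iff (μ := gaussianReal 0 1) measurableSet_Ioi).2 h
  refine gaussianReal_ne_zero_of_isOpen one_ne_zero (isOpen_Iio (a := (-1 : ℝ)))
    Set.nonempty_Iio 0 (measure_mono_null ?_ h2)
  intro y hy
  simpa using (le_of_lt hy : y ≤ -1)

/-- The event that none of the block sums with indices `M, …, M + r - 1` is very negative. -/
def blockEvent (N : ℕ → ℕ) (t : ℕ → ℝ) (M r : ℕ) : Set (ℕ → ℝ) :=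
  ⋂ i ∈ Finset.range r, {z | -t (M + i) < ∑ j ∈ Finset.Ico (N (M + i)) (N (M + i + 1)), z j}

theorem measurableSet_block (a b : ℕ) (s : ℝ) :
    MeasurableSet {z : ℕ → ℝ | s < ∑ j ∈ Finset.Ico a b, z j} :=
  measurableSet_lt measurable_const (by fun_prop)

theorem measure_blockEvent_le {N : ℕ → ℕ} (hN : StrictMono N) {t : ℕ → ℝ}
    (ht : ∀ m, t m ^ 2 ≤ N (m + 1) - N m) (M r : ℕ) :
    stdSeq (blockEvent N t M r) ≤ gaussianReal 0 1 (Set.Ioi (-1)) ^ r := by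
  induction r with
  | zero => simp [prob_le_one]
  | succ r ih =>
    have hsplit : blockEvent N t M (r + 1) = blockEvent N t M r ∩
        {z | -t (M + r) < ∑ j ∈ Finset.Ico (N (M + r)) (N (M + r + 1)), z j} := by
      simp only [blockEvent, Finset.range_add_one, Finset.set_biInter_insert]
      rw [Set.inter_comm]
    have hdisj : Disjoint (Finset.range (N (M + r)))
        (Finset.Ico (N (M + r)) (N (M + r + 1))) := by
      rw [Finset.disjoint_left]
      intro j hj hj'
      rw [Finset.mem_range] at hj
      rw [Finset.mem_Ico] at hj'
      omega
    rw [hsplit, measure_inter_eq_mul hdisj, pow_succ]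
    · gcongr
      have hcard : ((Finset.Ico (N (M + r)) (N (M + r + 1))).card : ℝ≥0) ≠ 0 := by
        have : N (M + r) < N (M + r + 1) := hN (Nat.lt_succ_self _)
        simp only [Nat.card_Ico, ne_eq, Nat.cast_eq_zero]
        omega
      have h := gaussianReal_Ioi_neg_le (t := t (M + r)) hcard (by
        rw [Nat.card_Ico, NNReal.coe_natCast, Nat.cast_sub (hN (Nat.lt_succ_self _)).le]
        exact ht _)
      rwa [← map_sum_coord, Measure.map_apply (by fun_prop) measurableSet_Ioi] at h
    · exact Finset.measurableSet_biInter _ fun i _ => measurableSet_block _ _ _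
    · exact measurableSet_block _ _ _
    · intro z
      simp only [blockEvent, Set.mem_iInter, Set.mem_ofPred_eq]
      refine forall₂_congr fun i hi => ?_
      rw [Finset.sum_congr rfl fun j hj => Set.indicator_of_mem ?_ z]
      have h1 := (Finset.mem_Ico.1 hj).2
      have h2 : N (M + i + 1) ≤ N (M + r) := hN.monotone (by
        have := Finset.mem_range.1 hi
        omega)
      simp only [Finset.coe_range, Set.mem_Iio]
      omega
    · intro z
      simp only [Set.mem_ofPred_eq]
      rw [Finset.sum_congr rfl fun j hj => Set.indicator_of_mem (by exact_mod_cast hj) z]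

theorem ae_exists_block_le {N : ℕ → ℕ} (hN : StrictMono N) {t : ℕ → ℝ}
    (ht : ∀ m, t m ^ 2 ≤ N (m + 1) - N m) :
    ∀ᵐ z ∂stdSeq, ∀ M, ∃ m ≥ M, ∑ j ∈ Finset.Ico (N m) (N (m + 1)), z j ≤ -t m := by
  rw [ae_all_iff]
  intro M
  have h0 : stdSeq (⋂ r, blockEvent N t M r) = 0 := by
    refine le_antisymm (ge_of_tendsto' (ENNReal.tendsto_pow_atTop_nhds_zero_of_lt_one
      gaussianReal_Ioi_lt_one) fun r => ?_) zero_le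
    exact (measure_mono (Set.iInter_subset _ r)).trans (measure_blockEvent_le hN ht M r)
  refine measure_mono_null (fun z hz => ?_) h0
  simp only [Set.mem_compl_iff, Set.mem_ofPred_eq, not_exists, not_and, not_le] at hz
  simp only [blockEvent, Set.mem_iInter, Set.mem_ofPred_eq]
  exact fun r i _ => hz (M + i) (by omega)

/-- The running average of standard normal observations takes a negative value at some
arbitrarily large time. -/
theorem ae_exists_runningAvg_neg (n₀ : ℕ) :
    ∀ᵐ z ∂stdSeq, ∃ n ≥ n₀, runningAvg z n < 0 := by
  -- The block ends grow so fast that `t m` is `m + 1` standard deviations of the sum up to `N m`,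
  -- yet at most one standard deviation of the next block. By Borel–Cantelli the former sum is
  -- eventually below `t m`, while infinitely many blocks contribute at most `-t m`.
  let N : ℕ → ℕ := fun m => ((m + 1).factorial) ^ 2
  let t : ℕ → ℝ := fun m => (m + 1) * (m + 1).factorial
  have hNle (m : ℕ) : m + 1 ≤ N m :=
    (Nat.self_le_factorial _).trans (Nat.le_self_pow two_ne_zero _)
  have hNR (m : ℕ) : (N (m + 1) : ℝ) = (m + 2) ^ 2 * N m := by
    simp only [N, Nat.factorial_succ (m + 1)]; push_cast; ring
  have htN (m : ℕ) : t m ^ 2 = (m + 1) ^ 2 * N m := by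
    simp only [N, t]; push_cast; ring
  have hN : StrictMono N := strictMono_nat_of_lt_succ fun m =>
    Nat.pow_lt_pow_left (Nat.factorial_lt_of_lt (by omega) (by omega)) two_ne_zero
  have ht (m : ℕ) : t m ^ 2 ≤ N (m + 1) - N m := by
    rw [hNR, htN]
    have : (0 : ℝ) ≤ N m := by positivity
    nlinarith [mul_nonneg (Nat.cast_nonneg m : (0 : ℝ) ≤ m) this]
  have hbc : ∑' m, stdSeq {z | t m ≤ ∑ j ∈ Finset.range (N m), z j} ≠ ⊤ := by
    have hs : Summable fun m : ℕ => Real.exp (-(1 / 2) * m) := by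
      simpa using Real.summable_pow_mul_exp_neg_nat_mul 0 (r := 1 / 2) (by norm_num)
    refine ne_top_of_le_ne_top hs.tsum_ofReal_ne_top (ENNReal.tsum_le_tsum fun m => ?_)
    refine (measure_sum_ge_le (N m) (by positivity)).trans (ENNReal.ofReal_le_ofReal ?_)
    rw [Real.exp_le_exp, htN]
    have : (0 : ℝ) < N m := by exact_mod_cast (by have := hNle m; omega : 0 < N m)
    have e : -((m + 1 : ℝ) ^ 2 * N m) / (2 * N m) = -(m + 1 : ℝ) ^ 2 / 2 := by field_simp
    rw [e]
    nlinarith [(Nat.cast_nonneg m : (0 : ℝ) ≤ m)]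
  filter_upwards [ae_exists_block_le hN ht, ae_eventually_notMem hbc] with z h1 h2
  obtain ⟨M, hM⟩ := eventually_atTop.1 h2
  obtain ⟨m, hm, hle⟩ := h1 (max M n₀)
  have hm1 := hM m (le_of_max_le_left hm)
  simp only [not_le] at hm1
  have hN1 := hNle (m + 1)
  have hm2 := le_of_max_le_right hm
  refine ⟨N (m + 1), by omega, div_neg_of_neg_of_pos ?_ (by
    exact_mod_cast (by omega : 0 < N (m + 1)))⟩
  rw [← Finset.sum_range_add_sum_Ico _ (hN (Nat.lt_succ_self m)).le]
  linarith

/-- A sequence that converges to a limit above one of its values has a last minimum. -/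
theorem exists_last_min {f : ℕ → ℝ} {l : ℝ} (hf : Tendsto f atTop (𝓝 l)) {n₀ m : ℕ}
    (hm : n₀ ≤ m) (h : f m < l) : ∃ p ≥ n₀, ∀ n > p, f p < f n := by
  classical
  obtain ⟨M, hM⟩ := eventually_atTop.1 (hf.eventually (eventually_gt_nhds h))
  have hmM : m < M := by
    by_contra hlt
    exact lt_irrefl _ (hM m (not_lt.1 hlt))
  obtain ⟨q, hq, hqmin⟩ := Finset.exists_min_image (Finset.Ico n₀ M) f
    ⟨m, Finset.mem_Ico.2 ⟨hm, hmM⟩⟩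
  -- The last minimizer is taken, so that later values are strictly larger.
  let S := {n ∈ Finset.Ico n₀ M | f n = f q}
  have hS : S.Nonempty := ⟨q, by simp [S, Finset.mem_Ico.1 hq]⟩
  have hp := S.max'_mem hS
  simp only [S, Finset.mem_filter, Finset.mem_Ico] at hp
  refine ⟨S.max' hS, hp.1.1, fun n hn => ?_⟩
  rw [hp.2]
  rcases lt_or_ge n M with hnM | hnM
  · have hmem : n ∈ Finset.Ico n₀ M := Finset.mem_Ico.2 ⟨hp.1.1.trans hn.le, hnM⟩
    refine lt_of_le_of_ne (hqmin n hmem) fun heq => ?_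
    exact absurd (S.le_max' n (by simp only [S, Finset.mem_filter]; exact ⟨hmem, heq.symm⟩))
      (not_le.2 hn)
  · exact (hqmin m (Finset.mem_Ico.2 ⟨hm, hmM⟩)).trans_lt (hM n hnM)

theorem ae_exists_last_min_runningAvg (n₀ : ℕ) :
    ∀ᵐ z ∂stdSeq, ∃ p ≥ n₀, ∀ n > p, runningAvg z p < runningAvg z n := by
  filter_upwards [tendsto_runningAvg, ae_exists_runningAvg_neg n₀] with z h1 ⟨m, hm, hneg⟩
  exact exists_last_min h1 hm hneg

/-! ### Deterministic analysis of the sampling path. -/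

section Path

variable {k n₀ : ℕ} {a : (ℕ → ℝ) → ℕ} {x : ℕ → ℕ → ℝ}

/-- The alternative with the largest sample mean after `t` greedy steps. -/
noncomputable def leader (a : (ℕ → ℝ) → ℕ) (n₀ : ℕ) (x : ℕ → ℕ → ℝ) (t : ℕ) : ℕ :=
  a fun i => runningAvg (x i) (sampleSizes a n₀ x t i)

theorem sampleSizes_succ (t : ℕ) :
    sampleSizes a n₀ x (t + 1) = Function.update (sampleSizes a n₀ x t) (leader a n₀ x t)
      (sampleSizes a n₀ x t (leader a n₀ x t) + 1) := rfl

theorem sampleSizes_succ_self (t : ℕ) : sampleSizes a n₀ x (t + 1) (leader a n₀ x t) =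
    sampleSizes a n₀ x t (leader a n₀ x t) + 1 := by
  rw [sampleSizes_succ, Function.update_self]

theorem sampleSizes_succ_of_ne {t i : ℕ} (h : i ≠ leader a n₀ x t) :
    sampleSizes a n₀ x (t + 1) i = sampleSizes a n₀ x t i := by
  rw [sampleSizes_succ, Function.update_of_ne h]

theorem le_sampleSizes (t i : ℕ) : n₀ ≤ sampleSizes a n₀ x t i := by
  induction t with
  | zero => exact le_rfl
  | succ t ih =>
    by_cases h : i = leader a n₀ x t
    · subst h; rw [sampleSizes_succ_self]; omega
    · rwa [sampleSizes_succ_of_ne h]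

theorem leader_lt (ha : IsArgmaxRule k a) (t : ℕ) : leader a n₀ x t < k := (ha _).1

theorem runningAvg_le_leader (ha : IsArgmaxRule k a) (t : ℕ) {i : ℕ} (hi : i < k) :
    runningAvg (x i) (sampleSizes a n₀ x t i) ≤
      runningAvg (x (leader a n₀ x t)) (sampleSizes a n₀ x t (leader a n₀ x t)) :=
  (ha fun i => runningAvg (x i) (sampleSizes a n₀ x t i)).2 i hi

theorem sum_sampleSizes (ha : IsArgmaxRule k a) (t : ℕ) :
    ∑ i ∈ Finset.range k, sampleSizes a n₀ x t i = n₀ * k + t := by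
  induction t with
  | zero => simp [sampleSizes, mul_comm]
  | succ t ih =>
    have hmem := Finset.mem_range.2 (leader_lt (n₀ := n₀) (x := x) ha t)
    rw [sampleSizes_succ, Finset.sum_update_of_mem hmem, ← add_assoc, ← ih,
      ← Finset.add_sum_erase _ _ hmem, Finset.sdiff_singleton_eq_erase]
    ring

/-- As long as one alternative stays above the level `c`, no alternative is sampled after it has
fallen below `c`. -/
theorem sampleSizes_le_crossingTime (ha : IsArgmaxRule k a) {c : ℝ} {b : ℕ} (hb : b < k)
    (hc : ∀ n ≥ n₀, c ≤ runningAvg (x b) n) (t i : ℕ) :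
    (sampleSizes a n₀ x t i : ℝ≥0∞) ≤ crossingTime c n₀ (x i) := by
  induction t with
  | zero => exact le_crossingTime_iff.2 fun n hn _ => hn
  | succ t ih =>
    by_cases h : i = leader a n₀ x t
    · subst h
      rw [sampleSizes_succ_self]
      refine le_crossingTime_iff.2 fun n hn hlt => ?_
      refine lt_of_le_of_ne (le_crossingTime_iff.1 ih n hn hlt) fun heq => ?_
      have h1 := runningAvg_le_leader (n₀ := n₀) (x := x) ha t hb
      have h2 := hc _ (le_sampleSizes (a := a) (x := x) t b)
      rw [heq] at h1
      linarith
    · rwa [sampleSizes_succ_of_ne h]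

/-- After a good alternative has been sampled at a sample size from which on its running average
beats every lower value of the other alternatives, only good alternatives lead. -/
theorem leader_mem_of_lt_sampleSizes (ha : IsArgmaxRule k a) {G : Finset ℕ} {i p : ℕ}
    (hiG : i ∈ G) (hik : i < k) (hp : n₀ ≤ p)
    (h : ∀ n > p, ∀ j ∉ G, ∀ m ≥ n₀, runningAvg (x j) m ≤ runningAvg (x i) p →
      runningAvg (x j) m < runningAvg (x i) n)
    {t : ℕ} (ht : p < sampleSizes a n₀ x t i) : leader a n₀ x t ∈ G := by
  have key (t : ℕ) (ht : p < sampleSizes a n₀ x t i)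
      (hle : ∀ j ∉ G, j < k → runningAvg (x j) (sampleSizes a n₀ x t j) ≤ runningAvg (x i) p) :
      leader a n₀ x t ∈ G := by
    by_contra hG
    have h1 := h _ ht _ hG _ (le_sampleSizes t _) (hle _ hG (leader_lt ha t))
    exact absurd (runningAvg_le_leader ha t hik) (not_le.2 h1)
  refine key t ht ?_
  induction t with
  | zero => exact absurd (show p < n₀ from ht) (by omega)
  | succ t ih =>
    intro j hj hjk
    have hlead : leader a n₀ x t ∈ G ∧
        runningAvg (x j) (sampleSizes a n₀ x t j) ≤ runningAvg (x i) p := by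
      by_cases hpt : p < sampleSizes a n₀ x t i
      · exact ⟨key t hpt (ih hpt), ih hpt j hj hjk⟩
      -- This is the step at which the sample size of `i` passes `p`: `i` leads with its average at
      -- `p`, which therefore bounds every bad average. From then on the leaders are good, so the
      -- bad averages are frozen.
      · have hil : i = leader a n₀ x t := by
          by_contra hne
          rw [sampleSizes_succ_of_ne hne] at ht
          exact hpt ht
        have hpe : sampleSizes a n₀ x t i = p := by
          have h1 := sampleSizes_succ_self (a := a) (n₀ := n₀) (x := x) t
          rw [← hil] at h1
          omega
        have h1 := runningAvg_le_leader (n₀ := n₀) (x := x) ha t hjk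
        rw [← hil, hpe] at h1
        exact ⟨hil ▸ hiG, h1⟩
    rw [sampleSizes_succ_of_ne fun hjl : j = leader a n₀ x t => hj (hjl ▸ hlead.1)]
    exact hlead.2

/-- If a bad alternative is selected although one alternative stays above the level `c`, then the
budget is at most the sum of the crossing times of the bad alternatives and of an amount which
depends on the good alternatives only. -/
theorem budget_le_of_selected_notMem (ha : IsArgmaxRule k a) {G : Finset ℕ}
    (hG : G ⊆ Finset.range k) {c : ℝ} {b : ℕ} (hb : b ∈ G)
    (hc : ∀ n ≥ n₀, c ≤ runningAvg (x b) n) {M : ℕ}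
    (h : ∀ i ∈ G, ∃ p ≥ n₀, p ≤ M ∧ ∀ n > p, ∀ j ∉ G, ∀ m ≥ n₀,
      runningAvg (x j) m ≤ runningAvg (x i) p → runningAvg (x j) m < runningAvg (x i) n)
    {B : ℕ} (hsel : selected a k n₀ B x ∉ G) :
    (B : ℝ≥0∞) ≤ (G.card * M : ℕ) +
      ∑ j ∈ Finset.range k \ G, crossingTime c n₀ (x j) := by
  have hbk := Finset.mem_range.1 (hG hb)
  set T := B - n₀ * k
  have hgood : ∀ i ∈ G, sampleSizes a n₀ x T i ≤ M := by
    intro i hi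
    obtain ⟨p, hp, hpM, hpn⟩ := h i hi
    refine le_trans (not_lt.1 fun hlt => hsel ?_) hpM
    exact leader_mem_of_lt_sampleSizes ha hi (Finset.mem_range.1 (hG hi)) hp hpn hlt
  calc (B : ℝ≥0∞) ≤ (∑ i ∈ Finset.range k, sampleSizes a n₀ x T i : ℕ) := by
        rw [sum_sampleSizes ha]
        -- Only an inequality, since the subtraction in `T` truncates when exploration alone exceeds
        -- the budget.
        exact_mod_cast (by omega : B ≤ n₀ * k + T)
    _ = (∑ i ∈ G, sampleSizes a n₀ x T i : ℕ) +
        ∑ j ∈ Finset.range k \ G, (sampleSizes a n₀ x T j : ℝ≥0∞) := by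
        rw [← Finset.sum_sdiff hG, Nat.cast_add, add_comm, Nat.cast_sum (Finset.range k \ G)]
    _ ≤ _ := by
        gcongr with j hj
        · exact Finset.sum_le_card_nsmul _ _ _ hgood
        · exact sampleSizes_le_crossingTime ha hbk hc T j

end Path

/-! ### From standard normal sequences to the observations of each alternative. -/

theorem runningAvg_affine (m s : ℝ) (z : ℕ → ℝ) {n : ℕ} (hn : 1 ≤ n) :
    runningAvg (fun j => m + s * z j) n = m + s * runningAvg z n := by
  have : (n : ℝ) ≠ 0 := by positivity
  simp only [runningAvg, Finset.sum_add_distrib, Finset.sum_const, Finset.card_range,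
    nsmul_eq_mul, ← Finset.mul_sum]
  field_simp

/-- This pathwise domination makes the moment bounds uniform over the bad alternatives, degenerate
ones included. -/
theorem crossingTime_affine_le {m s S x c : ℝ} (hs : 0 ≤ s) (hsS : s ≤ S) (hS : 0 < S)
    (hx : 0 < x) (hc : m + S * x ≤ c) {n₀ : ℕ} (hn₀ : 1 ≤ n₀) (z : ℕ → ℝ) :
    crossingTime c n₀ (fun j => m + s * z j) ≤ crossingTime x n₀ z := by
  refine le_iInf₂ fun n hn => crossingTime_le hn.1 ?_
  rw [runningAvg_affine _ _ _ (hn₀.trans hn.1)]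
  have : s * runningAvg z n < S * x := by
    rcases hs.eq_or_lt with rfl | hs
    · rw [zero_mul]; positivity
    · exact (mul_lt_mul_of_pos_left hn.2 hs).trans_le (by gcongr)
  linarith

section Rows

variable {Ω : Type*} [MeasurableSpace Ω] {P : Measure Ω} {X : ℕ → ℕ → Ω → ℝ} {μ σ : ℕ → ℝ}

theorem map_affine_gaussianReal (m s : ℝ) :
    (gaussianReal 0 1).map (fun y => m + |s| * y) = gaussianReal m (Real.toNNReal (s ^ 2)) := by
  have h : (fun y : ℝ => m + |s| * y) = (fun y => m + y) ∘ fun y => |s| * y := rfl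
  rw [h, ← Measure.map_map (by fun_prop) (by fun_prop), gaussianReal_map_const_mul,
    gaussianReal_map_const_add]
  congr 1
  · simp
  · ext; simp [sq_nonneg]

theorem map_row (hX : ∀ i j, Measurable (X i j))
    (hlaw : ∀ i j, P.map (X i j) = gaussianReal (μ i) (Real.toNNReal (σ i ^ 2)))
    (hindep : iIndepFun (fun p : ℕ × ℕ => X p.1 p.2) P) (i : ℕ) :
    P.map (fun ω j => X i j ω) = stdSeq.map fun z j => μ i + |σ i| * z j := by
  have hrow : iIndepFun (X i) P :=
    hindep.precomp (g := fun j => (i, j)) fun j j' h => (Prod.mk.inj h).2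
  rw [Measure.infinitePi_map_pi (X := fun _ => ℝ) (f := fun _ y => μ i + |σ i| * y) _
    fun _ => by fun_prop]
  simp_rw [map_affine_gaussianReal]
  exact (hrow.hasLaw_infinitePi (fun j => ⟨(hX i j).aemeasurable, hlaw i j⟩)
    (measurable_pi_lambda _ fun j => hX i j).aemeasurable).map_eq

/-- The array has a product law over pairs of indices; currying turns it into the product of the row
laws. -/
theorem iIndepFun_row [IsProbabilityMeasure P] (hX : ∀ i j, Measurable (X i j))
    (hindep : iIndepFun (fun p : ℕ × ℕ => X p.1 p.2) P) :
    iIndepFun (fun i ω j => X i j ω) P := by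
  have hpm (i j : ℕ) : IsProbabilityMeasure (P.map (X i j)) :=
    Measure.isProbabilityMeasure_map (hX i j).aemeasurable
  have hrow (i : ℕ) : P.map (fun ω j => X i j ω) = Measure.infinitePi fun j => P.map (X i j) :=
    (hindep.precomp (g := fun j => (i, j)) fun j j' h =>
      (Prod.mk.inj h).2).map_fun_eq_infinitePi_map fun j => hX i j
  rw [iIndepFun_iff_map_fun_eq_infinitePi_map fun i => measurable_pi_lambda _ fun j => hX i j]
  have hall : P.map (fun ω (p : ℕ × ℕ) => X p.1 p.2 ω) =
      Measure.infinitePi fun p : ℕ × ℕ => P.map (X p.1 p.2) :=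
    hindep.map_fun_eq_infinitePi_map fun p => hX p.1 p.2
  have hm : Measurable fun ω (p : ℕ × ℕ) => X p.1 p.2 ω :=
    measurable_pi_lambda _ fun p => hX p.1 p.2
  simp_rw [hrow]
  rw [← Measure.infinitePi_map_curry, ← hall, Measure.map_map (by fun_prop) hm]
  rfl

theorem ae_row (hX : ∀ i j, Measurable (X i j))
    (hlaw : ∀ i j, P.map (X i j) = gaussianReal (μ i) (Real.toNNReal (σ i ^ 2)))
    (hindep : iIndepFun (fun p : ℕ × ℕ => X p.1 p.2) P) (i : ℕ) {Q : (ℕ → ℝ) → Prop}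
    (hQ : MeasurableSet {y | Q y}) (h : ∀ᵐ z ∂stdSeq, Q fun j => μ i + |σ i| * z j) :
    ∀ᵐ ω ∂P, Q fun j => X i j ω := by
  have hφ : Measurable fun (z : ℕ → ℝ) j => μ i + |σ i| * z j := by fun_prop
  have hr : Measurable fun ω j => X i j ω := measurable_pi_lambda _ fun j => hX i j
  rw [← ae_map_iff hφ.aemeasurable hQ, ← map_row hX hlaw hindep] at h
  exact ae_of_ae_map hr.aemeasurable h

theorem lintegral_row (hX : ∀ i j, Measurable (X i j))
    (hlaw : ∀ i j, P.map (X i j) = gaussianReal (μ i) (Real.toNNReal (σ i ^ 2)))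
    (hindep : iIndepFun (fun p : ℕ × ℕ => X p.1 p.2) P) (i : ℕ) {f : (ℕ → ℝ) → ℝ≥0∞}
    (hf : Measurable f) :
    ∫⁻ ω, f (fun j => X i j ω) ∂P = ∫⁻ z, f (fun j => μ i + |σ i| * z j) ∂stdSeq := by
  rw [← lintegral_map hf (measurable_pi_lambda _ fun j => hX i j), map_row hX hlaw hindep,
    lintegral_map hf (by fun_prop)]

theorem ae_row_ne (hX : ∀ i j, Measurable (X i j))
    (hlaw : ∀ i j, P.map (X i j) = gaussianReal (μ i) (Real.toNNReal (σ i ^ 2)))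
    (hindep : iIndepFun (fun p : ℕ × ℕ => X p.1 p.2) P) {i : ℕ} {c : ℝ} (hc : μ i ≠ c) :
    ∀ᵐ ω ∂P, ∀ n ≥ 1, runningAvg (fun j => X i j ω) n ≠ c := by
  refine ae_row hX hlaw hindep i (Q := fun y => ∀ n ≥ 1, runningAvg y n ≠ c) ?_ ?_
  · simp only [Set.ofPred_forall]
    exact .iInter fun n => .iInter fun _ =>
      (measurableSet_eq_fun (measurable_runningAvg n) measurable_const).compl
  · filter_upwards [ae_runningAvg_ne ((c - μ i) / |σ i|)] with z hz n hn heq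
    rw [runningAvg_affine _ _ _ hn] at heq
    by_cases hs : |σ i| = 0
    · rw [hs, zero_mul, add_zero] at heq
      exact hc heq
    · refine hz n hn ?_
      rw [eq_div_iff hs]
      linarith

theorem ae_row_eq (hX : ∀ i j, Measurable (X i j))
    (hlaw : ∀ i j, P.map (X i j) = gaussianReal (μ i) (Real.toNNReal (σ i ^ 2)))
    (hindep : iIndepFun (fun p : ℕ × ℕ => X p.1 p.2) P) {i : ℕ} (hσ : σ i = 0) :
    ∀ᵐ ω ∂P, ∀ n ≥ 1, runningAvg (fun j => X i j ω) n = μ i := by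
  refine ae_row hX hlaw hindep i (Q := fun y => ∀ n ≥ 1, runningAvg y n = μ i) ?_ ?_
  · simp only [Set.ofPred_forall]
    exact .iInter fun n => .iInter fun _ =>
      measurableSet_eq_fun (measurable_runningAvg n) measurable_const
  · refine ae_of_all _ fun z n hn => ?_
    rw [runningAvg_affine _ _ _ hn, hσ]
    simp

theorem ae_row_last_min (hX : ∀ i j, Measurable (X i j))
    (hlaw : ∀ i j, P.map (X i j) = gaussianReal (μ i) (Real.toNNReal (σ i ^ 2)))
    (hindep : iIndepFun (fun p : ℕ × ℕ => X p.1 p.2) P) {i : ℕ} (hσ : σ i ≠ 0) {n₀ : ℕ}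
    (hn₀ : 1 ≤ n₀) :
    ∀ᵐ ω ∂P, ∃ p ≥ n₀, ∀ n > p,
      runningAvg (fun j => X i j ω) p < runningAvg (fun j => X i j ω) n := by
  refine ae_row hX hlaw hindep i
    (Q := fun y => ∃ p ≥ n₀, ∀ n > p, runningAvg y p < runningAvg y n) ?_ ?_
  · simp only [Set.ofPred_forall, Set.ofPred_exists, Set.ofPred_and]
    exact .iUnion fun p => (MeasurableSet.const _).inter <| .iInter fun n => .iInter fun _ =>
      measurableSet_lt (measurable_runningAvg p) (measurable_runningAvg n)
  · filter_upwards [ae_exists_last_min_runningAvg n₀] with z ⟨p, hp, h⟩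
    refine ⟨p, hp, fun n hn => ?_⟩
    rw [runningAvg_affine _ _ _ (by omega), runningAvg_affine _ _ _ (by omega)]
    have := mul_lt_mul_of_pos_left (h n hn) (abs_pos.2 hσ)
    linarith

/-- Almost surely, every good alternative has a sample size from which on its running average
beats every lower value of the bad alternatives. -/
theorem ae_exists_record (hX : ∀ i j, Measurable (X i j))
    (hlaw : ∀ i j, P.map (X i j) = gaussianReal (μ i) (Real.toNNReal (σ i ^ 2)))
    (hindep : iIndepFun (fun p : ℕ × ℕ => X p.1 p.2) P) {n₀ : ℕ} (hn₀ : 1 ≤ n₀) {G : Finset ℕ}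
    (hG : ∀ i ∈ G, ∀ j ∉ G, μ j < μ i) :
    ∀ᵐ ω ∂P, ∀ i ∈ G, ∃ p ≥ n₀, ∀ n > p, ∀ j ∉ G, ∀ m ≥ n₀,
      runningAvg (fun l => X j l ω) m ≤ runningAvg (fun l => X i l ω) p →
        runningAvg (fun l => X j l ω) m < runningAvg (fun l => X i l ω) n := by
  rw [ae_all_iff]; intro i
  rw [ae_all_iff]; intro hi
  -- A constant average has no strict last minimum. There `p = n₀` works, because a bad alternative,
  -- having a different mean, almost surely never ties with the constant.
  by_cases hσ : σ i = 0
  · have hne : ∀ᵐ ω ∂P, ∀ j ∉ G, ∀ n ≥ 1, runningAvg (fun l => X j l ω) n ≠ μ i := by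
      rw [ae_all_iff]; intro j
      rw [ae_all_iff]; intro hj
      exact ae_row_ne hX hlaw hindep (hG i hi j hj).ne
    filter_upwards [ae_row_eq hX hlaw hindep hσ, hne] with ω h1 h2
    refine ⟨n₀, le_rfl, fun n hn j hj m hm hle => ?_⟩
    rw [h1 n (by omega)]
    rw [h1 n₀ hn₀] at hle
    exact lt_of_le_of_ne hle (h2 j hj m (by omega))
  · filter_upwards [ae_row_last_min hX hlaw hindep hσ hn₀] with ω ⟨p, hp, h⟩
    exact ⟨p, hp, fun n hn j _ m _ hle => hle.trans_lt (h n hn)⟩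

end Rows

/-! ### A weak law of large numbers. -/

section LargeNumbers

variable {Ω : Type*} [MeasurableSpace Ω] {P : Measure Ω} {T : ℕ → Ω → ℝ≥0∞}

theorem memLp_toReal {f : Ω → ℝ≥0∞} (hf : Measurable f) (h : ∫⁻ ω, f ω ^ 2 ∂P ≠ ⊤) :
    MemLp (fun ω => (f ω).toReal) 2 P := by
  rw [memLp_two_iff_integrable_sq hf.ennreal_toReal.aestronglyMeasurable]
  simp_rw [← ENNReal.toReal_pow]
  exact integrable_toReal_of_lintegral_ne_top (hf.pow_const 2).aemeasurable h

/-- A weak law of large numbers for independent variables with uniformly bounded first and second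
moments: their partial sums rarely exceed a linear bound that is steeper than the mean. -/
theorem tendsto_measure_le_sum [IsProbabilityMeasure P] (hT : ∀ j, Measurable (T j)) (hind : iIndepFun T P)
    {J : ℕ → Finset ℕ} (hJ : ∀ k, J k ⊆ Finset.range k) {m V : ℝ}
    (hm0 : 0 ≤ m) (hV0 : 0 ≤ V)
    (hmean : ∀ k, ∀ j ∈ J k, ∫⁻ ω, T j ω ∂P ≤ ENNReal.ofReal m)
    (hsq : ∀ k, ∀ j ∈ J k, ∫⁻ ω, T j ω ^ 2 ∂P ≤ ENNReal.ofReal V) {t : ℝ} (hmt : m < t) {K : ℕ}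
    {B : ℕ → ℕ} (hB : ∀ k, t * k - 1 ≤ B k) :
    Tendsto (fun k => P {ω | (B k : ℝ≥0∞) ≤ K + ∑ j ∈ J k, T j ω}) atTop (𝓝 0) := by
  let Y : ℕ → Ω → ℝ := fun j ω => (T j ω).toReal
  have hLp (k j : ℕ) (hj : j ∈ J k) : MemLp (Y j) 2 P :=
    memLp_toReal (hT j) (ne_top_of_le_ne_top ENNReal.ofReal_ne_top (hsq k j hj))
  have hfin (k j : ℕ) (hj : j ∈ J k) : ∀ᵐ ω ∂P, T j ω < ⊤ :=
    ae_lt_top (hT j) (ne_top_of_le_ne_top ENNReal.ofReal_ne_top (hmean k j hj))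
  have hEY (k j : ℕ) (hj : j ∈ J k) : P[Y j] ≤ m := by
    rw [integral_toReal (hT j).aemeasurable (hfin k j hj)]
    exact ENNReal.toReal_le_of_le_ofReal hm0 (hmean k j hj)
  have hVar (k j : ℕ) (hj : j ∈ J k) : variance (Y j) P ≤ V := by
    refine (variance_le_expectation_sq (hLp k j hj).1).trans ?_
    have e : (Y j) ^ 2 = fun ω => (T j ω ^ 2).toReal := by
      ext ω; simp [Y]
    rw [e, integral_toReal ((hT j).pow_const 2).aemeasurable]
    · exact ENNReal.toReal_le_of_le_ofReal hV0 (hsq k j hj)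
    · filter_upwards [hfin k j hj] with ω hω
      exact ENNReal.pow_lt_top hω
  have hcard (k : ℕ) : ((J k).card : ℝ) ≤ k := by
    exact_mod_cast (Finset.card_le_card (hJ k)).trans_eq (Finset.card_range k)
  -- The slack `(t - m) * k` is split in two: one half absorbs `K` and the rounding of the budget,
  -- the other is the deviation in Chebyshev's inequality.
  set ε := (t - m) / 2 with hε
  have hε0 : 0 < ε := by rw [hε]; linarith
  have hbound : ∀ᶠ k : ℕ in atTop, P {ω | (B k : ℝ≥0∞) ≤ K + ∑ j ∈ J k, T j ω} ≤
      ENNReal.ofReal (V / ε ^ 2 * (k : ℝ)⁻¹) := by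
    obtain ⟨k₀, hk₀⟩ := exists_nat_ge ((K + 1) / ε)
    filter_upwards [eventually_ge_atTop (max k₀ 1)] with k hk
    have hk1 : (1 : ℝ) ≤ k := by exact_mod_cast le_of_max_le_right hk
    have hkK : K + 1 ≤ ε * k := by
      have h1 : (k₀ : ℝ) ≤ k := by exact_mod_cast le_of_max_le_left hk
      have h2 := (div_le_iff₀ hε0).1 (hk₀.trans h1)
      linarith
    have hS : MemLp (∑ j ∈ J k, Y j) 2 P := memLp_finsetSum' _ (hLp k)
    have hES : P[∑ j ∈ J k, Y j] ≤ m * k := by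
      have : P[∑ j ∈ J k, Y j] = ∑ j ∈ J k, P[Y j] := by
        simp only [Finset.sum_apply]
        exact integral_finsetSum _ fun j hj => (hLp k j hj).integrable one_le_two
      rw [this]
      calc ∑ j ∈ J k, P[Y j] ≤ (J k).card • m := Finset.sum_le_card_nsmul _ _ _ (hEY k)
        _ = m * (J k).card := by rw [nsmul_eq_mul, mul_comm]
        _ ≤ m * k := by exact mul_le_mul_of_nonneg_left (hcard k) ‹_›
    have hVS : variance (∑ j ∈ J k, Y j) P ≤ V * k := by
      rw [IndepFun.variance_sum (hLp k) fun i _ j _ hij =>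
        (hind.indepFun hij).comp ENNReal.measurable_toReal ENNReal.measurable_toReal]
      calc ∑ j ∈ J k, variance (Y j) P ≤ (J k).card • V :=
            Finset.sum_le_card_nsmul _ _ _ (hVar k)
        _ = V * (J k).card := by rw [nsmul_eq_mul, mul_comm]
        _ ≤ V * k := by exact mul_le_mul_of_nonneg_left (hcard k) ‹_›
    have hcheb := meas_ge_le_variance_div_sq hS (c := ε * k) (by positivity)
    refine (measure_mono_ae ?_).trans (hcheb.trans (ENNReal.ofReal_le_ofReal ?_))
    · have hall : ∀ᵐ ω ∂P, ∀ j ∈ J k, T j ω < ⊤ :=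
        (Finset.eventually_all _).2 (hfin k)
      filter_upwards [hall] with ω hω hle
      change (B k : ℝ≥0∞) ≤ K + ∑ j ∈ J k, T j ω at hle
      change ε * k ≤ |(∑ j ∈ J k, Y j) ω - P[∑ j ∈ J k, Y j]|
      have hsum : ∑ j ∈ J k, T j ω ≠ ⊤ := (ENNReal.sum_lt_top.2 hω).ne
      have h1 := ENNReal.toReal_mono (ENNReal.add_ne_top.2 ⟨by simp, hsum⟩) hle
      rw [ENNReal.toReal_add (by simp) hsum, ENNReal.toReal_sum fun j hj => (hω j hj).ne,
        ENNReal.toReal_natCast, ENNReal.toReal_natCast] at h1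
      refine le_trans ?_ (le_abs_self _)
      rw [Finset.sum_apply]
      have h2 := hB k
      have h3 : t * k = m * k + 2 * (ε * k) := by rw [hε]; ring
      change _ ≤ (K : ℝ) + ∑ j ∈ J k, Y j ω at h1
      linarith
    · rw [div_le_iff₀ (by positivity)]
      refine hVS.trans (le_of_eq ?_)
      field_simp
  refine tendsto_of_tendsto_of_tendsto_of_le_of_le' tendsto_const_nhds ?_
    (Eventually.of_forall fun _ => zero_le) hbound
  have : Tendsto (fun k : ℕ => V / ε ^ 2 * (k : ℝ)⁻¹) atTop (𝓝 0) := by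
    simpa using (tendsto_inv_atTop_nhds_zero_nat (𝕜 := ℝ)).const_mul (V / ε ^ 2)
  simpa [Function.comp_def] using (ENNReal.continuous_ofReal.tendsto 0).comp this

end LargeNumbers

/-! ### Stabilization of the good set and the selection probability. -/

theorem mem_goodSet {μ : ℕ → ℝ} {δ : ℝ} {k i : ℕ} :
    i ∈ goodSet μ δ k ↔ i < k ∧ μ 0 - δ < μ i := by
  simp [goodSet]

/-- If the numbers of good alternatives stay bounded, the sets of good alternatives are eventually
constant. -/
theorem exists_goodSet_eq {μ : ℕ → ℝ} {δ : ℝ}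
    (h : limsup (fun k => ((goodSet μ δ k).card : ℕ∞)) atTop < ⊤) :
    ∃ k₀, ∀ k ≥ k₀, goodSet μ δ k = goodSet μ δ k₀ := by
  obtain ⟨n, hn⟩ := ENat.ne_top_iff_exists.1 h.ne
  have hev : ∀ᶠ k in atTop, ((goodSet μ δ k).card : ℕ∞) < (n + 1 : ℕ) :=
    eventually_lt_of_limsup_lt (by rw [← hn]; exact_mod_cast n.lt_succ_self)
  have hmono : Monotone (goodSet μ δ) := fun k l hkl i hi => by
    rw [mem_goodSet] at hi ⊢
    exact ⟨hi.1.trans_le hkl, hi.2⟩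
  have hcard (k : ℕ) : (goodSet μ δ k).card ≤ n := by
    obtain ⟨l, hl, hkl⟩ := (hev.and (eventually_ge_atTop k)).exists
    have h1 : (goodSet μ δ l).card < n + 1 := by exact_mod_cast hl
    exact (Finset.card_le_card (hmono hkl)).trans (Nat.lt_succ_iff.1 h1)
  have hbdd : BddAbove (Set.range fun k => (goodSet μ δ k).card) :=
    ⟨n, by rintro _ ⟨k, rfl⟩; exact hcard k⟩
  obtain ⟨k₀, hk₀⟩ := Nat.sSup_mem (Set.range_nonempty _) hbdd
  refine ⟨k₀, fun k hk => (Finset.eq_of_subset_of_card_le (hmono hk) ?_).symm⟩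
  change (goodSet μ δ k₀).card = _ at hk₀
  rw [hk₀]
  exact le_csSup hbdd ⟨k, rfl⟩

section Selection

variable {Ω : Type*} [MeasurableSpace Ω] {P : Measure Ω} [IsProbabilityMeasure P]
  {X : ℕ → ℕ → Ω → ℝ} {μ σ : ℕ → ℝ} {σbar δ : ℝ} {n₀ : ℕ}

/-- The probability that a bad alternative exhausts the budget tends to zero. -/
theorem tendsto_measure_budget_le (hX : ∀ i j, Measurable (X i j))
    (hlaw : ∀ i j, P.map (X i j) = gaussianReal (μ i) (Real.toNNReal (σ i ^ 2)))
    (hindep : iIndepFun (fun p : ℕ × ℕ => X p.1 p.2) P)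
    (hσbar : 0 < σbar) (hσ : ∀ i, σ i ^ 2 ≤ σbar ^ 2) (hn₀ : 1 ≤ n₀)
    {d t : ℝ} (hd : d < δ) (hC : C ((δ - d) / σbar) n₀ < ENNReal.ofReal t) {K : ℕ} {B : ℕ → ℕ}
    (hB : ∀ k, t * k - 1 ≤ B k) :
    Tendsto (fun k => P {ω | (B k : ℝ≥0∞) ≤ K + ∑ j ∈ Finset.range k \ goodSet μ δ k,
      crossingTime (μ 0 - d) n₀ fun l => X j l ω}) atTop (𝓝 0) := by
  set x := (δ - d) / σbar with hx
  have hx0 : 0 < x := div_pos (by linarith) hσbar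
  have hdom (k j : ℕ) (hj : j ∈ Finset.range k \ goodSet μ δ k) (z : ℕ → ℝ) :
      crossingTime (μ 0 - d) n₀ (fun l => μ j + |σ j| * z l) ≤ crossingTime x n₀ z := by
    rw [Finset.mem_sdiff, Finset.mem_range, mem_goodSet] at hj
    have hμ : μ j ≤ μ 0 - δ := not_lt.1 fun h => hj.2 ⟨hj.1, h⟩
    refine crossingTime_affine_le (abs_nonneg _) (abs_le_of_sq_le_sq (hσ j) hσbar.le) hσbar hx0
      ?_ hn₀ z
    rw [hx, mul_div_cancel₀ _ hσbar.ne']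
    linarith
  have hCfin := (C_lt_top hx0 n₀).ne
  have hVfin := (lintegral_sq_crossingTime_lt_top hx0 n₀).ne
  refine tendsto_measure_le_sum (m := (C x n₀).toReal)
    (V := (∫⁻ z, crossingTime x n₀ z ^ 2 ∂stdSeq).toReal)
    (fun j => (measurable_crossingTime _ _).comp (measurable_pi_lambda _ fun l => hX j l))
    ((iIndepFun_row hX hindep).comp (fun _ => crossingTime (μ 0 - d) n₀)
      fun _ => measurable_crossingTime _ _)
    (fun k => Finset.sdiff_subset) ENNReal.toReal_nonneg ENNReal.toReal_nonneg ?_ ?_ ?_ hB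
  · intro k j hj
    rw [ENNReal.ofReal_toReal hCfin]
    refine (lintegral_row hX hlaw hindep j (measurable_crossingTime _ _)).trans_le ?_
    exact lintegral_mono (hdom k j hj)
  · intro k j hj
    rw [ENNReal.ofReal_toReal hVfin]
    refine (lintegral_row hX hlaw hindep j ((measurable_crossingTime _ _).pow_const 2)).trans_le ?_
    exact lintegral_mono fun z => by gcongr; exact hdom k j hj z
  · exact (ENNReal.lt_ofReal_iff_toReal_lt hCfin).1 hC

/-- If a good alternative stays above the level `μ 0 - d`, and all good alternatives have their
records by time `M`, then a good alternative is selected with high probability. -/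
theorem measure_le_liminf_PGS (hX : ∀ i j, Measurable (X i j))
    (hlaw : ∀ i j, P.map (X i j) = gaussianReal (μ i) (Real.toNNReal (σ i ^ 2)))
    (hindep : iIndepFun (fun p : ℕ × ℕ => X p.1 p.2) P)
    (hσbar : 0 < σbar) (hσ : ∀ i, σ i ^ 2 ≤ σbar ^ 2) (hn₀ : 1 ≤ n₀)
    {a : ℕ → (ℕ → ℝ) → ℕ} (ha : ∀ k, 1 ≤ k → IsArgmaxRule k (a k))
    {d t : ℝ} (hd : d < δ) (hC : C ((δ - d) / σbar) n₀ < ENNReal.ofReal t) {B : ℕ → ℕ}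
    (hB : ∀ k, t * k - 1 ≤ B k) {k₀ : ℕ} (hk₀ : ∀ k ≥ k₀, goodSet μ δ k = goodSet μ δ k₀)
    (M : ℕ) :
    P {ω | (∃ b ∈ goodSet μ δ k₀, ∀ n ≥ n₀, μ 0 - d ≤ runningAvg (fun l => X b l ω) n) ∧
      ∀ i ∈ goodSet μ δ k₀, ∃ p ≥ n₀, p ≤ M ∧ ∀ n > p, ∀ j ∉ goodSet μ δ k₀, ∀ m ≥ n₀,
        runningAvg (fun l => X j l ω) m ≤ runningAvg (fun l => X i l ω) p →
          runningAvg (fun l => X j l ω) m < runningAvg (fun l => X i l ω) n} ≤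
      liminf (fun k => PGS P X μ δ (a k) k n₀ (B k)) atTop := by
  set A : Set Ω := {ω | (∃ b ∈ goodSet μ δ k₀, ∀ n ≥ n₀,
      μ 0 - d ≤ runningAvg (fun l => X b l ω) n) ∧
      ∀ i ∈ goodSet μ δ k₀, ∃ p ≥ n₀, p ≤ M ∧ ∀ n > p, ∀ j ∉ goodSet μ δ k₀, ∀ m ≥ n₀,
        runningAvg (fun l => X j l ω) m ≤ runningAvg (fun l => X i l ω) p →
          runningAvg (fun l => X j l ω) m < runningAvg (fun l => X i l ω) n} with hA
  have hlim := tendsto_measure_budget_le (K := (goodSet μ δ k₀).card * M)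
    hX hlaw hindep hσbar hσ hn₀ hd hC hB
  have hle : ∀ᶠ k in atTop, P A - P {ω | (B k : ℝ≥0∞) ≤ ((goodSet μ δ k₀).card * M : ℕ) +
      ∑ j ∈ Finset.range k \ goodSet μ δ k, crossingTime (μ 0 - d) n₀ fun l => X j l ω} ≤
        PGS P X μ δ (a k) k n₀ (B k) := by
    filter_upwards [eventually_ge_atTop (max k₀ 1)] with k hk
    have hG := hk₀ k (le_of_max_le_left hk)
    rw [tsub_le_iff_right]
    refine (measure_mono fun ω hω => ?_).trans (measure_union_le _ _)
    by_cases hsel : selected (a k) k n₀ (B k) (fun i j => X i j ω) ∈ goodSet μ δ k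
    · exact Or.inl hsel
    · obtain ⟨⟨b, hb, hbn⟩, hrec⟩ := hω
      refine Or.inr ?_
      have hGk : goodSet μ δ k ⊆ Finset.range k := Finset.filter_subset _ _
      simp only [← hG] at hb hrec ⊢
      exact budget_le_of_selected_notMem (ha k (le_of_max_le_right hk)) hGk hb hbn hrec hsel
  have htend := ENNReal.Tendsto.sub (tendsto_const_nhds (x := P A)) hlim
    (Or.inl (measure_ne_top P A))
  rw [tsub_zero] at htend
  rw [← htend.liminf_eq]
  exact liminf_le_liminf hle

/-- At `d` itself the mean bound equals the budget rate and the weak law has no slack. The levels `u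
M` increase strictly to `d`, and strict monotonicity of `C` supplies slack for each; the same index
`M` also bounds the record times, so the events `A M` increase and almost surely cover the target
event. -/
theorem measure_exists_good_le_liminf_PGS (hX : ∀ i j, Measurable (X i j))
    (hlaw : ∀ i j, P.map (X i j) = gaussianReal (μ i) (Real.toNNReal (σ i ^ 2)))
    (hindep : iIndepFun (fun p : ℕ × ℕ => X p.1 p.2) P)
    (hσbar : 0 < σbar) (hσ : ∀ i, σ i ^ 2 ≤ σbar ^ 2) (hn₀ : 1 ≤ n₀)
    {a : ℕ → (ℕ → ℝ) → ℕ} (ha : ∀ k, 1 ≤ k → IsArgmaxRule k (a k))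
    {d t : ℝ} (hd0 : 0 < d) (hd : d < δ) (hC : C ((δ - d) / σbar) n₀ = ENNReal.ofReal t)
    {B : ℕ → ℕ} (hB : ∀ k, t * k - 1 ≤ B k) {k₀ : ℕ}
    (hk₀ : ∀ k ≥ k₀, goodSet μ δ k = goodSet μ δ k₀) :
    P {ω | ∃ i ∈ goodSet μ δ k₀,
      ((μ 0 - d : ℝ) : EReal) < minRunningAvg (fun j => X i j ω) n₀} ≤
      liminf (fun k => PGS P X μ δ (a k) k n₀ (B k)) atTop := by
  obtain ⟨u, hu, hu0, hul⟩ := exists_seq_strictMono_tendsto' hd0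
  let A : ℕ → Set Ω := fun M => {ω | (∃ b ∈ goodSet μ δ k₀, ∀ n ≥ n₀,
      μ 0 - u M ≤ runningAvg (fun l => X b l ω) n) ∧
      ∀ i ∈ goodSet μ δ k₀, ∃ p ≥ n₀, p ≤ M ∧ ∀ n > p, ∀ j ∉ goodSet μ δ k₀, ∀ m ≥ n₀,
        runningAvg (fun l => X j l ω) m ≤ runningAvg (fun l => X i l ω) p →
          runningAvg (fun l => X j l ω) m < runningAvg (fun l => X i l ω) n}
  have hAmono : Monotone A := by
    rintro M M' hMM ω ⟨⟨b, hb, hbn⟩, hrec⟩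
    refine ⟨⟨b, hb, fun n hn => le_trans ?_ (hbn n hn)⟩, fun i hi => ?_⟩
    · have := hu.monotone hMM
      linarith
    · obtain ⟨p, hp, hpM, h⟩ := hrec i hi
      exact ⟨p, hp, hpM.trans hMM, h⟩
  have hA (M : ℕ) : P (A M) ≤ liminf (fun k => PGS P X μ δ (a k) k n₀ (B k)) atTop := by
    have hud : u M < d := (hu0 M).2
    refine measure_le_liminf_PGS hX hlaw hindep hσbar hσ hn₀ ha (hud.trans hd) ?_ hB hk₀ M
    rw [← hC]
    exact C_lt_C (div_pos (by linarith) hσbar) (by gcongr) hn₀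
  have hsub : P {ω | ∃ i ∈ goodSet μ δ k₀,
      ((μ 0 - d : ℝ) : EReal) < minRunningAvg (fun j => X i j ω) n₀} ≤ P (⋃ M, A M) := by
    refine measure_mono_ae ?_
    have hbad : ∀ i ∈ goodSet μ δ k₀, ∀ j ∉ goodSet μ δ k₀, μ j < μ i := by
      intro i hi j hj
      rw [mem_goodSet] at hi
      -- Here `j` may be at least `k₀`; passing to a larger index with the same good set shows that
      -- its mean is bad.
      rw [← hk₀ (max k₀ (j + 1)) (le_max_left _ _), mem_goodSet] at hj
      have hjk : j < max k₀ (j + 1) := by omega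
      exact (not_lt.1 fun h => hj ⟨hjk, h⟩).trans_lt hi.2
    filter_upwards [ae_exists_record hX hlaw hindep hn₀ hbad] with ω hrec hω
    obtain ⟨b, hb, hmin⟩ := hω
    obtain ⟨r, hr1, hr2⟩ := EReal.lt_iff_exists_real_btwn.1 hmin
    have hr1' : μ 0 - d < r := by exact_mod_cast hr1
    choose! p hp hpn using hrec
    have hev : ∀ᶠ M in atTop, μ 0 - u M < r ∧ (goodSet μ δ k₀).sup p ≤ M :=
      ((hul.const_sub (μ 0)).eventually (eventually_lt_nhds hr1')).and (eventually_ge_atTop _)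
    obtain ⟨M, hM, hpM⟩ := hev.exists
    refine Set.mem_iUnion.2 ⟨M, ⟨b, hb, fun n hn => hM.le.trans ?_⟩, fun i hi =>
      ⟨p i, hp i hi, (Finset.le_sup hi).trans hpM, hpn i hi⟩⟩
    have := hr2.le.trans (iInf₂_le n hn)
    exact_mod_cast this
  exact hsub.trans ((hAmono.measure_iUnion).trans_le (iSup_le hA))

end Selection

end EFG

theorem proposition2 {Ω : Type*} [MeasurableSpace Ω] (P : Measure Ω) [IsProbabilityMeasure P]
    (X : ℕ → ℕ → Ω → ℝ) (μ σ : ℕ → ℝ) (σbar δ ng : ℝ) (n₀ : ℕ) (B : ℕ → ℕ)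
    (a : ℕ → (ℕ → ℝ) → ℕ)
    (hX : ∀ i j, Measurable (X i j))
    (hlaw : ∀ i j, P.map (X i j) = gaussianReal (μ i) (Real.toNNReal (σ i ^ 2)))
    (hindep : iIndepFun (fun p : ℕ × ℕ => X p.1 p.2) P)
    (hbest : ∀ i, μ i ≤ μ 0)
    (hσbar : 0 < σbar) (hσ : ∀ i, σ i ^ 2 ≤ σbar ^ 2)
    (hδ : 0 < δ)
    (hgood : limsup (fun k => ((EFG.goodSet μ δ k).card : ℕ∞)) atTop < ⊤)
    (hn₀ : 1 ≤ n₀)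
    (ha : ∀ k, 1 ≤ k → EFG.IsArgmaxRule k (a k))
    (hB : ∀ k, |(B k : ℝ) - (n₀ + ng) * k| < 1)
    (hng : EFG.C (δ / σbar) n₀ < ENNReal.ofReal (n₀ + ng)) :
    (∃ δ₀ ∈ Set.Ioo 0 δ, EFG.C ((δ - δ₀) / σbar) n₀ = ENNReal.ofReal (n₀ + ng)) ∧
    ∀ δ₀ ∈ Set.Ioo 0 δ, EFG.C ((δ - δ₀) / σbar) n₀ = ENNReal.ofReal (n₀ + ng) →
      limsup (fun k => P {ω | ∃ i ∈ EFG.goodSet μ δ k,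
          ((μ 0 - δ₀ : ℝ) : EReal) < EFG.minRunningAvg (fun j => X i j ω) n₀}) atTop
        ≤ liminf (fun k => EFG.PGS P X μ δ (a k) k n₀ (B k)) atTop ∧
      P {ω | ((μ 0 - δ₀ : ℝ) : EReal) < EFG.minRunningAvg (fun j => X 0 j ω) n₀}
        ≤ limsup (fun k => P {ω | ∃ i ∈ EFG.goodSet μ δ k,
          ((μ 0 - δ₀ : ℝ) : EReal) < EFG.minRunningAvg (fun j => X i j ω) n₀}) atTop := by
  obtain ⟨k₀, hk₀⟩ := EFG.exists_goodSet_eq hgood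
  have hB' : ∀ k, (n₀ + ng) * k - 1 ≤ (B k : ℝ) := fun k => by
    have := (abs_lt.1 (hB k)).1
    linarith
  refine ⟨?_, fun δ₀ hδ₀ hC => ⟨?_, ?_⟩⟩
  · obtain ⟨y, hy, hyC⟩ := EFG.exists_C_eq hn₀ ENNReal.ofReal_lt_top (div_pos hδ hσbar) hng
    have hyσ : y * σbar < δ := (lt_div_iff₀ hσbar).1 hy.2
    -- This solves `(δ - δ₀) / σbar = y`.
    refine ⟨δ - y * σbar, ⟨by linarith, by linarith [mul_pos hy.1 hσbar]⟩, ?_⟩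
    rw [sub_sub_cancel, mul_div_cancel_right₀ _ hσbar.ne', hyC]
  · refine le_trans (le_of_eq ?_) (EFG.measure_exists_good_le_liminf_PGS hX hlaw hindep hσbar hσ
      hn₀ ha hδ₀.1 hδ₀.2 hC hB' hk₀)
    refine (limsup_congr ?_).trans (limsup_const _)
    filter_upwards [eventually_ge_atTop k₀] with k hk
    rw [hk₀ k hk]
  · refine le_limsup_of_frequently_le (Eventually.frequently ?_)
    filter_upwards [eventually_ge_atTop 1] with k hk
    exact measure_mono fun ω hω => ⟨0, EFG.mem_goodSet.2 ⟨hk, by linarith⟩, hω⟩
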